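/- For integers $n, k \ge 1$ the van der Waerden complex $\mathrm{vdW}(n,k)$ is the simplicial complex on the vertex set $\{1,2,\ldots,n\}$ whose facets are all the arithmetic progressions $\{x, x+d, x+2d, \ldots, x+kd\}$ with $d$ a positive integer and $1 \le x < x+kd \le n$ (each vertex is a face). For an integer $a > 1$, let $L(a) = \operatorname{lcm}(1,2,\ldots,a)$. Let $p$ be a prime and $\alpha \ge 1$ an integer such that $p^{\alpha}$ is the largest power of $p$ dividing $L(a)$, that is, $p^{\alpha} \mid L(a)$ and $p^{\alpha+1} \nmid L(a)$. Let $k$ be an integer with $k \ge L(a)/p^{\alpha-1}$, and let $n$ be an integer with $a k < n \le (a+1) k$. Then (the geometric realization of) the van der Waerden complex $\mathrm{vdW}(n,k)$ is contractible. -/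

import Mathlib

/-- The least common multiple `L(a) = lcm(1, 2, …, a)`. -/
def lcmUpTo (a : ℕ) : ℕ := (Finset.Icc 1 a).lcm id

/-- The arithmetic progression `{x, x + d, x + 2 d, …, x + k d}`. -/
def arithProg (k x d : ℕ) : Finset ℕ := (Finset.range (k + 1)).image fun i => x + i * d

/-- The van der Waerden complex `vdW(n, k)`: the simplicial complex on the vertex set
`[n] = {1, …, n}` generated by the arithmetic progressions `{x, x + d, …, x + k d}` with `d` a
positive integer and `1 ≤ x < x + k d ≤ n`. Every vertex is a face, and a nonempty subset
of `[n]` with more than one element is a face exactly when it lies in such a progression.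
(Following Mathlib's convention, the empty face is not listed.) -/
def vdW (n k : ℕ) : AbstractSimplicialComplex (Finset.Icc 1 n) where
  faces := {s | s.Nonempty ∧ ((∃ v, s = {v}) ∨
    ∃ x d : ℕ, 0 < d ∧ 1 ≤ x ∧ x < x + k * d ∧ x + k * d ≤ n ∧
      s.map (Function.Embedding.subtype _) ⊆ arithProg k x d)}
  isRelLowerSet_faces := by
    rintro s ⟨hs, h⟩
    refine ⟨hs, fun t hts ht => ⟨ht, ?_⟩⟩
    have hts' : t ⊆ s := hts
    rcases h with ⟨v, rfl⟩ | ⟨x, d, hd, hx, hlt, hle, hsub⟩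
    · exact Or.inl ⟨v, (Finset.subset_singleton_iff.1 hts').resolve_left ht.ne_empty⟩
    · exact Or.inr ⟨x, d, hd, hx, hlt, hle, (Finset.map_subset_map.2 hts').trans hsub⟩
  singleton_mem := fun v => ⟨Finset.singleton_nonempty v, Or.inl ⟨v, rfl⟩⟩

open Classical in
/-- The geometric simplicial complex in `ℝ^V` that realizes an abstract simplicial complex on
a finite vertex set `V`: the vertex `v` is placed at the standard basis vector `e_v`. -/
noncomputable def geometricComplex {V : Type*} [Fintype V]
    (K : AbstractSimplicialComplex V) : Geometry.SimplicialComplex ℝ (V → ℝ) :=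
  Geometry.SimplicialComplex.ofAffineIndependent
    (K.toPreAbstractSimplicialComplex.map fun v => (Pi.single v 1 : V → ℝ))
    (by
      refine (Pi.linearIndependent_single_one V ℝ).affineIndependent.range.mono fun x hx => ?_
      simp only [Set.mem_iUnion, Finset.mem_coe] at hx
      obtain ⟨_, ⟨_, _, rfl⟩, hx⟩ := hx
      obtain ⟨v, _, rfl⟩ := Finset.mem_image.1 hx
      exact ⟨v, rfl⟩)

/-- The geometric realization `|K|` of a finite abstract simplicial complex: the union of the
simplices `conv {e_v | v ∈ s}`, `s` a face of `K`, with the topology induced from `ℝ^V`. -/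
noncomputable abbrev geometricRealization {V : Type*} [Fintype V]
    (K : AbstractSimplicialComplex V) : Set (V → ℝ) :=
  (geometricComplex K).space

/-! Write `L(a) = p ^ α * q` with `q` prime to `p`; the hypothesis on `k` says `p * q ≤ k`.
Complexes are families of finite sets, with the empty face included. Expansion from the empty family
is collapsibility read backwards, and elementary expansions along nonempty faces preserve the
homotopy type, so everything reduces to combinatorics.

Since `a * k < n ≤ (a + 1) * k`, only differences `d ≤ a` occur. The faces with `d < a` form one
complex. Those with `d = a` fall into residue classes mod `a` and are glued on one class at a time;
each class meets what is already there in its own faces with `d < a`. Both the class and this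
intersection expand from `∅`, so gluing preserves contractibility (`Expands.exists_common`).

Each piece is built by adjoining its points in increasing order, so only the link of the largest
point `m` has to expand from `∅` (`expands_linkComplex`). There the differences `d` are filtered by
their `p`-adic valuation. If `p ^ (i + 2)` does not divide `d`, then `d` divides `p ^ (i + 1) * q`;
if also `p ^ i ≤ d`, this number is at most `k * d`. Hence the point at distance `p ^ (i + 1) * q`
below `m` can be added to any face with such a `d`: it is a cone apex at the first stage and the
toggled vertex at later ones. A smaller `d` is first multiplied by a power of `p`. -/

/-! ### Elementary expansions of families of finite sets. -/

/-- An elementary expansion: adjoin `s` and `insert c s` to a family that contains every other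
subset of `insert c s`. -/
def ElementaryExpansion {V : Type*} [DecidableEq V] (K L : Set (Finset V)) : Prop :=
  ∃ (s : Finset V) (c : V), c ∉ s ∧ s ∉ K ∧
    (∀ t ⊆ insert c s, t ≠ s → t ≠ insert c s → t ∈ K) ∧ L = K ∪ {s, insert c s}

/-- `K` expands to `L` if `L` arises from `K` by finitely many elementary expansions. -/
def Expands {V : Type*} [DecidableEq V] (K L : Set (Finset V)) : Prop :=
  Relation.ReflTransGen ElementaryExpansion K L

namespace Expands

variable {V : Type*} [DecidableEq V]

theorem _root_.ElementaryExpansion.isLowerSet {K L : Set (Finset V)}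
    (h : ElementaryExpansion K L) (hK : IsLowerSet K) : IsLowerSet L := by
  obtain ⟨s, c, -, -, hb, rfl⟩ := h
  intro x y hyx hx
  have key : y ⊆ insert c s → y ∈ K ∪ {s, insert c s} := by
    intro hy
    by_cases h1 : y = s
    · exact Or.inr (Or.inl h1)
    by_cases h2 : y = insert c s
    · exact Or.inr (Or.inr h2)
    exact Or.inl (hb y hy h1 h2)
  rcases hx with hx | rfl | rfl
  · exact Or.inl (hK hyx hx)
  · exact key (hyx.trans (Finset.subset_insert _ _))
  · exact key hyx

/-- If `L \ K` is closed under adjoining and deleting the vertex `c`, then `K` expands to `L`. -/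
theorem of_toggle {K L : Set (Finset V)} (c : V) (hK : IsLowerSet K) (hL : IsLowerSet L)
    (hfin : (L \ K).Finite) (hKL : K ⊆ L) (hins : ∀ s ∈ L, s ∉ K → insert c s ∈ L)
    (hers : ∀ s ∈ L, s ∉ K → s.erase c ∉ K) : Expands K L := by
  induction hn : (L \ K).ncard using Nat.strong_induction_on generalizing K with
  | _ n ih =>
    subst hn
    rcases (L \ K).eq_empty_or_nonempty with he | hne
    · rw [hKL.antisymm (Set.sdiff_eq_empty.1 he)]
      exact Relation.ReflTransGen.refl
    -- A missing set of least cardinality avoids `c`, and every other missing subset of `insert c s`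
    -- would yield a smaller one on erasing `c`; so `s` and `insert c s` form an elementary
    -- expansion.
    obtain ⟨s, ⟨hsL, hsK⟩, hmin⟩ := Set.exists_min_image _ Finset.card hfin hne
    have hcs : c ∉ s := by
      intro hc
      have := hmin (s.erase c) ⟨hL (Finset.erase_subset _ _) hsL, hers s hsL hsK⟩
      have := Finset.card_erase_lt_of_mem hc
      omega
    have hcL := hins s hsL hsK
    have hb : ∀ t ⊆ insert c s, t ≠ s → t ≠ insert c s → t ∈ K := by
      intro t ht h1 h2
      by_contra htK
      have htL := hL ht hcL
      have hsub : t.erase c ⊆ s := by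
        rw [← Finset.subset_insert_iff]; exact ht
      have heq := Finset.eq_of_subset_of_card_le hsub
        (hmin _ ⟨hL (Finset.erase_subset _ _) htL, hers t htL htK⟩)
      by_cases hct : c ∈ t
      · exact h2 (by rw [← heq, Finset.insert_erase hct])
      · exact h1 (by rw [← heq, Finset.erase_eq_of_notMem hct])
    have hstep : ElementaryExpansion K (K ∪ {s, insert c s}) := ⟨s, c, hcs, hsK, hb, rfl⟩
    have hsubL : K ∪ {s, insert c s} ⊆ L := by
      rintro t (h | rfl | rfl)
      exacts [hKL h, hsL, hcL]
    refine Relation.ReflTransGen.head hstep (ih _ ?_ (hstep.isLowerSet hK) ?_ hsubL ?_ ?_ rfl)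
    · refine Set.ncard_lt_ncard ⟨fun t ht => ⟨ht.1, fun h => ht.2 (Or.inl h)⟩, fun h => ?_⟩ hfin
      exact (h ⟨hsL, hsK⟩).2 (Or.inr (Or.inl rfl))
    · exact hfin.subset fun t ht => ⟨ht.1, fun h => ht.2 (Or.inl h)⟩
    · exact fun t ht htK => hins t ht fun h => htK (Or.inl h)
    · rintro t ht htK (h | h | h)
      · exact hers t ht (fun h => htK (Or.inl h)) h
      · apply htK
        by_cases hct : c ∈ t
        · exact Or.inr (Or.inr (by
            rw [Set.mem_singleton_iff, ← h, Finset.insert_erase hct]))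
        · exact Or.inr (Or.inl (by rw [← h, Finset.erase_eq_of_notMem hct]))
      · have : c ∈ t.erase c := by rw [h]; exact Finset.mem_insert_self _ _
        exact Finset.notMem_erase _ _ this

/-- A cone expands from the empty family. -/
theorem of_cone {L : Set (Finset V)} (c : V) (hL : IsLowerSet L) (hfin : L.Finite)
    (hins : ∀ s ∈ L, insert c s ∈ L) : Expands ∅ L :=
  of_toggle c (fun _ _ _ h => h.elim) hL (hfin.subset Set.sdiff_subset) (Set.empty_subset _)
    (fun s hs _ => hins s hs) (fun _ _ _ h => h)

/-- Adjoining a new vertex whose link expands from the empty family is an expansion. -/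
theorem union_insert {X A : Set (Finset V)} {w : V} (hX : IsLowerSet X)
    (hw : ∀ s ∈ X, w ∉ s) (hA : Expands ∅ A) (hAX : A ⊆ X) :
    Expands X (X ∪ insert w '' A) := by
  induction hA with
  | refl =>
    rw [Set.image_empty, Set.union_empty]
    exact Relation.ReflTransGen.refl
  | @tail A B _ hAB ih =>
    obtain ⟨s, c, hcs, hsA, hb, rfl⟩ := hAB
    refine (ih (Set.subset_union_left.trans hAX)).tail ?_
    have hsX : s ∈ X := hAX (Or.inr (Or.inl rfl))
    have hcX : insert c s ∈ X := hAX (Or.inr (Or.inr rfl))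
    have hwc : w ∉ insert c s := hw _ hcX
    have hws : w ∉ s := hw _ hsX
    have hne : c ≠ w := fun h => hwc (h ▸ Finset.mem_insert_self _ _)
    -- The expansion of the link along `s` lifts to one along `insert w s`; the initial one, with `s
    -- = ∅`, creates the vertex `w`.
    refine ⟨insert w s, c, ?_, ?_, ?_, ?_⟩
    · simp [hne, hcs]
    · rintro (h | ⟨t, ht, h⟩)
      · exact hw _ h (Finset.mem_insert_self _ _)
      · have hwt : w ∉ t := hw _ (hAX (Or.inl ht))
        have : t = s := by
          rw [← Finset.erase_insert hwt, h, Finset.erase_insert hws]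
        exact hsA (this ▸ ht)
    · intro t ht h1 h2
      rw [Finset.insert_comm] at ht h2
      have hsub : t.erase w ⊆ insert c s := by rwa [← Finset.subset_insert_iff]
      by_cases hwt : w ∈ t
      · refine Or.inr ⟨t.erase w, hb _ hsub ?_ ?_, Finset.insert_erase hwt⟩
        · intro h; exact h1 (by rw [← h, Finset.insert_erase hwt])
        · intro h; exact h2 (by rw [← h, Finset.insert_erase hwt])
      · rw [Finset.erase_eq_of_notMem hwt] at hsub
        exact Or.inl (hX hsub hcX)
    · rw [Set.image_union, Set.image_pair, Finset.insert_comm w c s, Set.union_assoc]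

/-- If `Y` and `X ∩ Y` expand from the empty family, then `X` and `X ∪ Y` have a common
expansion. -/
theorem exists_common {X Y : Set (Finset V)} {w : V} (hX : IsLowerSet X) (hY : IsLowerSet Y)
    (hwX : ∀ s ∈ X, w ∉ s) (hwY : ∀ s ∈ Y, w ∉ s) (hfin : Y.Finite)
    (hYe : Expands ∅ Y) (hI : Expands ∅ (X ∩ Y)) :
    ∃ Z, Expands X Z ∧ Expands (X ∪ Y) Z := by
  have hwXY : ∀ s ∈ X ∪ Y, w ∉ s := fun s hs => hs.elim (hwX s) (hwY s)
  refine ⟨X ∪ Y ∪ insert w '' Y, ?_,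
    union_insert (hX.union hY) hwXY hYe Set.subset_union_right⟩
  refine (union_insert hX hwX hI Set.inter_subset_left).trans ?_
  have lower : ∀ {P Q : Set (Finset V)}, IsLowerSet P → IsLowerSet Q → Q ⊆ P →
      IsLowerSet (P ∪ insert w '' Q) := by
    rintro P Q hP hQ hQP s t hts (hs | ⟨u, hu, rfl⟩)
    · exact Or.inl (hP hts hs)
    have hsub : t.erase w ⊆ u := by rwa [← Finset.subset_insert_iff]
    by_cases hwt : w ∈ t
    · exact Or.inr ⟨_, hQ hsub hu, Finset.insert_erase hwt⟩
    · rw [Finset.erase_eq_of_notMem hwt] at hsub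
      exact Or.inl (hP hsub (hQP hu))
  -- The common expansion is the union with the cone over `Y`. From `X`, the cone over `X ∩ Y` comes
  -- first; the sets then missing are those of `Y \ X`, with and without `w`, and toggling `w` pairs
  -- them.
  refine of_toggle w (lower hX (hX.inter hY) Set.inter_subset_left)
    (lower (hX.union hY) hY Set.subset_union_right) ?_ ?_ ?_ ?_
  · refine (hfin.union (hfin.image (insert w))).subset ?_
    rintro s ⟨(hs | hs) | hs, hn⟩
    · exact (hn (Or.inl hs)).elim
    · exact Or.inl hs
    · exact Or.inr hs
  · exact Set.union_subset_union Set.subset_union_left (Set.image_mono Set.inter_subset_right)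
  · rintro s ((hs | hs) | ⟨t, ht, rfl⟩) hn
    · exact (hn (Or.inl hs)).elim
    · exact Or.inr ⟨s, hs, rfl⟩
    · rw [Finset.insert_idem]; exact Or.inr ⟨t, ht, rfl⟩
  · have hmem : ∀ t ∈ Y, t ∈ X ∪ insert w '' (X ∩ Y) → t ∈ X := by
      rintro t ht (h | ⟨u, -, rfl⟩)
      · exact h
      · exact (hwY _ ht (Finset.mem_insert_self _ _)).elim
    rintro s ((hs | hs) | ⟨t, ht, rfl⟩) hn h
    · exact hn (Or.inl hs)
    · rw [Finset.erase_eq_of_notMem (hwY _ hs)] at h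
      exact hn h
    · rw [Finset.erase_insert (hwY _ ht)] at h
      exact hn (Or.inr ⟨t, ⟨hmem t ht h, ht⟩, rfl⟩)

end Expands

/-! ### Expansions preserve the homotopy type of the realization. -/

/-- The realization in `V → ℝ` of a family of finite sets, in barycentric coordinates. -/
def barycentricSpace {V : Type*} (K : Set (Finset V)) : Set (V → ℝ) :=
  {x | ∃ s ∈ K, (∀ v, 0 ≤ x v) ∧ (∀ v ∉ s, x v = 0) ∧ ∑ v ∈ s, x v = 1}

theorem inf'_eq_zero_of_mem_barycentricSpace {V : Type*} {K : Set (Finset V)}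
    {s : Finset V} (hs : s.Nonempty) (hK : IsLowerSet K) (hsK : s ∉ K)
    {x : V → ℝ} (hx : x ∈ barycentricSpace K) : s.inf' hs x = 0 := by
  obtain ⟨t, ht, h0, hsupp, -⟩ := hx
  have hst : ¬ s ⊆ t := fun h => hsK (hK h ht)
  obtain ⟨v, hv, hvt⟩ := Finset.not_subset.1 hst
  exact le_antisymm ((Finset.inf'_le _ hv).trans (hsupp v hvt).le)
    (Finset.le_inf' _ _ fun v _ => h0 v)

section Collapse

variable {V : Type*} [DecidableEq V]

/-- Move along the direction pointing from the face `s` to the vertex `c`, so that for `r = 1` the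
smallest barycentric coordinate on `s` becomes zero. -/
noncomputable def collapseMap (s : Finset V) (hs : s.Nonempty) (c : V) (r : ℝ) (x : V → ℝ) :
    V → ℝ :=
  fun v => x v + r * s.inf' hs x * (if v = c then (s.card : ℝ) else if v ∈ s then -1 else 0)

theorem continuous_collapseMap (s : Finset V) (hs : s.Nonempty) (c : V) :
    Continuous fun y : ℝ × (V → ℝ) => collapseMap s hs c y.1 y.2 := by
  have h : Continuous fun y : ℝ × (V → ℝ) => s.inf' hs y.2 := by
    have := Continuous.finset_inf'_apply hs
      (f := fun v (y : ℝ × (V → ℝ)) => y.2 v) (fun v _ => by fun_prop)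
    exact this
  unfold collapseMap
  fun_prop

theorem collapseMap_zero (s : Finset V) (hs : s.Nonempty) (c : V) (x : V → ℝ) :
    collapseMap s hs c 0 x = x := by
  ext v; simp [collapseMap]

theorem collapseMap_of_inf'_eq_zero {s : Finset V} (hs : s.Nonempty) (c : V) (r : ℝ) {x : V → ℝ}
    (h : s.inf' hs x = 0) : collapseMap s hs c r x = x := by
  ext v; simp [collapseMap, h]

variable {K : Set (Finset V)} {s : Finset V} {c : V}

theorem sum_collapseMap (hs : s.Nonempty) (hcs : c ∉ s) (r : ℝ) (x : V → ℝ) :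
    ∑ v ∈ insert c s, collapseMap s hs c r x v = ∑ v ∈ insert c s, x v := by
  have h : ∑ v ∈ s, (if v = c then (s.card : ℝ) else if v ∈ s then -1 else 0)
      = ∑ v ∈ s, (-1 : ℝ) :=
    Finset.sum_congr rfl fun v hv => by
      rw [if_neg (ne_of_mem_of_not_mem hv hcs), if_pos hv]
  simp only [collapseMap, Finset.sum_add_distrib, ← Finset.mul_sum]
  rw [Finset.sum_insert hcs (f := fun v => if v = c then (s.card : ℝ) else _), h]
  simp

theorem collapseMap_nonneg (hs : s.Nonempty) (hcs : c ∉ s) {r : ℝ} (hr0 : 0 ≤ r) (hr1 : r ≤ 1)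
    {x : V → ℝ} (hx : ∀ v, 0 ≤ x v) (v : V) : 0 ≤ collapseMap s hs c r x v := by
  have h0 : 0 ≤ s.inf' hs x := Finset.le_inf' _ _ fun v _ => hx v
  unfold collapseMap
  split_ifs with h1 h2
  · have := hx v; positivity
  · have : s.inf' hs x ≤ x v := Finset.inf'_le _ h2
    nlinarith
  · simpa using hx v

theorem collapseMap_mem (hs : s.Nonempty) (hcs : c ∉ s) (hK : IsLowerSet K) (hsK : s ∉ K)
    {r : ℝ} (hr0 : 0 ≤ r) (hr1 : r ≤ 1) {x : V → ℝ}
    (hx : x ∈ barycentricSpace (K ∪ {s, insert c s})) :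
    collapseMap s hs c r x ∈ barycentricSpace (K ∪ {s, insert c s}) := by
  obtain ⟨t, ht, h0, hsupp, hsum⟩ := hx
  rcases ht with ht | ht
  · rw [collapseMap_of_inf'_eq_zero hs c r
      (inf'_eq_zero_of_mem_barycentricSpace hs hK hsK ⟨t, ht, h0, hsupp, hsum⟩)]
    exact ⟨t, Or.inl ht, h0, hsupp, hsum⟩
  have hts : t ⊆ insert c s := by
    rcases ht with rfl | rfl
    exacts [Finset.subset_insert _ _, subset_rfl]
  have hsum' : ∑ v ∈ insert c s, x v = 1 := by
    rw [← hsum]; exact (Finset.sum_subset hts fun v _ hv => hsupp v hv).symm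
  refine ⟨insert c s, Or.inr (Or.inr rfl), collapseMap_nonneg hs hcs hr0 hr1 h0, ?_, ?_⟩
  · intro v hv
    have h1 : v ≠ c := fun h => hv (h ▸ Finset.mem_insert_self _ _)
    have h2 : v ∉ s := fun h => hv (Finset.mem_insert_of_mem h)
    simp [collapseMap, h1, h2, hsupp v fun h => hv (hts h)]
  · rw [sum_collapseMap hs hcs, hsum']

/-- At time one a vertex of `s` with minimal coordinate gets coordinate zero, so the image lies in a
face of `insert c s` missing that vertex, and such faces belong to `K`. -/
theorem collapseMap_one_mem (hs : s.Nonempty) (hcs : c ∉ s) (hK : IsLowerSet K) (hsK : s ∉ K)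
    (hb : ∀ t ⊆ insert c s, t ≠ s → t ≠ insert c s → t ∈ K) {x : V → ℝ}
    (hx : x ∈ barycentricSpace (K ∪ {s, insert c s})) :
    collapseMap s hs c 1 x ∈ barycentricSpace K := by
  obtain ⟨t, ht, h0, hsupp, hsum⟩ := collapseMap_mem hs hcs hK hsK zero_le_one le_rfl hx
  rcases ht with ht | ht
  · exact ⟨t, ht, h0, hsupp, hsum⟩
  have hts : t ⊆ insert c s := by
    rcases ht with rfl | rfl
    exacts [Finset.subset_insert _ _, subset_rfl]
  obtain ⟨v, hv, hmin⟩ := Finset.exists_mem_eq_inf' hs x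
  have hvc : v ≠ c := fun h => hcs (h ▸ hv)
  have hv0 : collapseMap s hs c 1 x v = 0 := by
    simp [collapseMap, hvc, hv, hmin]
  refine ⟨(insert c s).erase v, hb _ (Finset.erase_subset _ _) ?_ ?_, h0, ?_, ?_⟩
  · intro h
    exact Finset.notMem_erase v (insert c s) (h.symm ▸ hv)
  · intro h
    exact Finset.notMem_erase v (insert c s) (h.symm ▸ Finset.mem_insert_of_mem hv)
  · intro u hu
    by_cases huv : u = v
    · rw [huv, hv0]
    · exact hsupp u fun h => hu (Finset.mem_erase.2 ⟨huv, hts h⟩)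
  · rw [Finset.sum_erase _ hv0]
    exact (Finset.sum_subset hts fun v _ hv => hsupp v hv).symm.trans hsum

/-- An elementary expansion along a nonempty face is a homotopy equivalence. -/
theorem nonempty_homotopyEquiv_of_elementaryExpansion (hs : s.Nonempty) (hcs : c ∉ s)
    (hK : IsLowerSet K) (hsK : s ∉ K)
    (hb : ∀ t ⊆ insert c s, t ≠ s → t ≠ insert c s → t ∈ K) :
    Nonempty (ContinuousMap.HomotopyEquiv (barycentricSpace K)
      (barycentricSpace (K ∪ {s, insert c s}))) := by
  have hsub : barycentricSpace K ⊆ barycentricSpace (K ∪ {s, insert c s}) :=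
    fun x ⟨t, ht, h⟩ => ⟨t, Or.inl ht, h⟩
  let i : C(barycentricSpace K, barycentricSpace (K ∪ {s, insert c s})) :=
    ⟨Set.inclusion hsub, continuous_inclusion hsub⟩
  let r : C(barycentricSpace (K ∪ {s, insert c s}), barycentricSpace K) :=
    ⟨fun x => ⟨collapseMap s hs c 1 x.1, collapseMap_one_mem hs hcs hK hsK hb x.2⟩,
      Continuous.subtype_mk ((continuous_collapseMap s hs c).comp
        (continuous_const.prodMk continuous_subtype_val)) _⟩
  have hri : r.comp i = ContinuousMap.id _ := by
    ext1 x
    exact Subtype.ext (collapseMap_of_inf'_eq_zero hs c 1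
      (inf'_eq_zero_of_mem_barycentricSpace hs hK hsK x.2))
  have hir : ContinuousMap.Homotopic (ContinuousMap.id _) (i.comp r) :=
    ⟨{ toFun := fun y => ⟨collapseMap s hs c y.1.1 y.2.1,
        collapseMap_mem hs hcs hK hsK y.1.2.1 y.1.2.2 y.2.2⟩
       continuous_toFun := Continuous.subtype_mk ((continuous_collapseMap s hs c).comp
        ((continuous_subtype_val.comp continuous_fst).prodMk
          (continuous_subtype_val.comp continuous_snd))) _
       map_zero_left := fun x => Subtype.ext (collapseMap_zero s hs c x.1)
       map_one_left := fun _ => rfl }⟩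
  exact ⟨⟨i, r, hri ▸ ContinuousMap.Homotopic.refl _, hir.symm⟩⟩

end Collapse

namespace Expands

variable {V : Type*} [DecidableEq V]

theorem isLowerSet {K L : Set (Finset V)} (h : Expands K L) (hK : IsLowerSet K) :
    IsLowerSet L := by
  induction h with
  | refl => exact hK
  | tail _ h ih => exact h.isLowerSet ih

theorem subset {K L : Set (Finset V)} (h : Expands K L) : K ⊆ L := by
  induction h with
  | refl => exact subset_rfl
  | tail _ h ih =>
    obtain ⟨s, c, -, -, -, rfl⟩ := h
    exact ih.trans Set.subset_union_left

/-- Having `∅ ∈ K` forces every expansion to be along a nonempty face, where the retraction is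
available. -/
theorem contractibleSpace_iff {K L : Set (Finset V)} (h : Expands K L) (hK : IsLowerSet K)
    (hne : ∅ ∈ K) :
    ContractibleSpace (barycentricSpace K) ↔ ContractibleSpace (barycentricSpace L) := by
  induction h with
  | refl => rfl
  | @tail A B hKA hAB ih =>
    rw [ih]
    have hA := Expands.isLowerSet hKA hK
    have hA0 := Expands.subset hKA hne
    obtain ⟨s, c, hcs, hsA, hb, rfl⟩ := hAB
    have hs : s.Nonempty := Finset.nonempty_iff_ne_empty.2 fun h => hsA (h ▸ hA0)
    obtain ⟨e⟩ := nonempty_homotopyEquiv_of_elementaryExpansion hs hcs hA hsA hb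
    exact ⟨fun _ => e.symm.contractibleSpace, fun _ => e.contractibleSpace⟩

/-- A nonempty complex that expands from the empty family is contractible. -/
theorem contractibleSpace {L : Set (Finset V)} (h : Expands ∅ L) (hne : ∅ ∈ L) :
    ContractibleSpace (barycentricSpace L) := by
  rcases Relation.ReflTransGen.cases_head h with rfl | ⟨A, hA, hAL⟩
  · exact hne.elim
  have hlow := hA.isLowerSet fun _ _ _ h => h.elim
  obtain ⟨s, c, hcs, -, hb, rfl⟩ := hA
  -- Otherwise `∅` would have to lie in the empty family; so the first expansion creates a single
  -- point.
  have hs : s = ∅ := by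
    by_contra hs
    exact hb ∅ (Finset.empty_subset _) (Ne.symm hs) (Finset.insert_ne_empty _ _).symm
  subst hs
  rw [← Expands.contractibleSpace_iff hAL hlow (Or.inr (Or.inl rfl))]
  have : barycentricSpace (∅ ∪ {∅, insert c ∅}) = {(Pi.single c 1 : V → ℝ)} := by
    ext x
    constructor
    · rintro ⟨t, (ht | rfl | rfl), h0, hsupp, hsum⟩
      · exact ht.elim
      · simp at hsum
      · ext v
        by_cases hv : v = c
        · subst hv; simpa using hsum
        · rw [hsupp v (by simpa using hv), Pi.single_eq_of_ne hv]
    · rintro rfl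
      refine ⟨_, Or.inr (Or.inr rfl), fun v => ?_, fun v hv => ?_, by simp⟩
      · by_cases hv : v = c
        · subst hv; simp
        · rw [Pi.single_eq_of_ne hv]
      · exact Pi.single_eq_of_ne (by simpa using hv) _
  rw [this]
  infer_instance

end Expands

/-! ### Divisibility and powers of `p`. -/

theorem Nat.Prime.dvd_pow_mul_of_not_pow_succ_dvd {p q α i d : ℕ} (hp : p.Prime)
    (hd : d ∣ p ^ α * q) (hpd : ¬ p ^ (i + 1) ∣ d) : d ∣ p ^ i * q := by
  have hd0 : d ≠ 0 := fun h => hpd (h ▸ dvd_zero _)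
  obtain ⟨s, u, hu, rfl⟩ := Nat.exists_eq_pow_mul_and_not_dvd hd0 p hp.ne_one
  have hsi : s ≤ i := by
    by_contra h
    exact hpd (Dvd.dvd.mul_right (pow_dvd_pow p (by omega)) u)
  have hcop : Nat.Coprime u (p ^ α) :=
    (Nat.Coprime.pow_left α ((Nat.Prime.coprime_iff_not_dvd hp).2 hu)).symm
  exact mul_dvd_mul (pow_dvd_pow p hsi) (hcop.dvd_of_dvd_mul_left ((Dvd.intro_left _ rfl).trans hd))

/-- The intervals `[p ^ i, p ^ (i + 1))` have ratio `p`, so multiplying by `p` cannot jump over one.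
This raises a difference that is too small for `k * d` to reach the apex. -/
theorem Nat.Prime.exists_mul_pow_mem_Ico {p : ℕ} (hp : p.Prime) {i e : ℕ} (he : 0 < e)
    (hei : e < p ^ (i + 1)) : ∃ j, p ^ i ≤ e * p ^ j ∧ e * p ^ j < p ^ (i + 1) := by
  by_cases h : p ^ i ≤ e
  · exact ⟨0, by simpa using h, by simpa using hei⟩
  have hex : ∃ j, p ^ i ≤ e * p ^ j := ⟨i, Nat.le_mul_of_pos_left _ he⟩
  refine ⟨Nat.find hex, Nat.find_spec hex, ?_⟩
  obtain ⟨j, hj⟩ : ∃ j, Nat.find hex = j + 1 :=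
    Nat.exists_eq_succ_of_ne_zero fun h0 => h (by simpa [h0] using Nat.find_spec hex)
  have hlt := Nat.find_min hex (m := j) (by omega)
  rw [hj, pow_succ, pow_succ, ← mul_assoc]
  exact Nat.mul_lt_mul_of_pos_right (not_le.1 hlt) hp.pos

/-- The size bound keeps the `p`-part of `e * p ^ j` at most `p ^ i`, while its prime-to-`p` part
already divides `e`. So raising `e` keeps all distances divisible. -/
theorem Nat.Prime.mul_pow_dvd_of_lt {p : ℕ} (hp : p.Prime) {i e j v : ℕ} (he : 0 < e)
    (hlt : e * p ^ j < p ^ (i + 1)) (hev : e ∣ v) (hpv : p ^ i ∣ v) : e * p ^ j ∣ v := by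
  obtain ⟨s, u, hu, rfl⟩ := Nat.exists_eq_pow_mul_and_not_dvd he.ne' p hp.ne_one
  have hu0 : 0 < u := Nat.pos_of_ne_zero fun h => hu (h ▸ dvd_zero _)
  have hlt' : p ^ (s + j) < p ^ (i + 1) := by
    refine lt_of_le_of_lt ?_ hlt
    rw [pow_add, mul_assoc, mul_comm u, ← mul_assoc]
    exact Nat.le_mul_of_pos_right _ hu0
  have hsj : s + j < i + 1 := (Nat.pow_lt_pow_iff_right hp.one_lt).1 hlt'
  have h1 : p ^ (s + j) ∣ v := (pow_dvd_pow p (by omega)).trans hpv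
  have h2 : u ∣ v := (Dvd.intro_left _ rfl).trans hev
  have hcop : Nat.Coprime (p ^ (s + j)) u :=
    Nat.Coprime.pow_left _ ((Nat.Prime.coprime_iff_not_dvd hp).2 hu)
  have := hcop.mul_dvd_of_dvd_of_dvd h1 h2
  rwa [pow_add, mul_assoc, mul_comm _ u, ← mul_assoc] at this

/-! ### Links of the largest point. -/

/-- The finite sets of points below `m` whose distances to `m` are, for one `d` satisfying `D`,
multiples of `d` and of `c` that are at most `k * d` and at most `R`. -/
def linkComplex (m k c R : ℕ) (D : ℕ → Prop) : Set (Finset ℕ) :=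
  {s | ∃ d, D d ∧ ∀ v ∈ s, v < m ∧ d ∣ m - v ∧ c ∣ m - v ∧ m - v ≤ k * d ∧ m - v ≤ R}

section Link

variable {m k c R : ℕ}

theorem linkComplex_isLowerSet (D : ℕ → Prop) : IsLowerSet (linkComplex m k c R D) :=
  fun _ _ hts ⟨d, hd, h⟩ => ⟨d, hd, fun v hv => h v (hts hv)⟩

theorem linkComplex_finite (D : ℕ → Prop) : (linkComplex m k c R D).Finite :=
  (Finset.finite_toSet (Finset.range m).powerset).subset fun _ ⟨_, _, h⟩ =>
    Finset.mem_coe.2 (Finset.mem_powerset.2 fun v hv => Finset.mem_range.2 (h v hv).1)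

variable {p q α b : ℕ}

/-- If a common multiple fits into all relevant progressions, it is the apex of a cone. -/
theorem expands_linkComplex_base (hp : p.Prime) (hk : p * q ≤ k)
    (hb : ∀ d, 0 < d → d ≤ b → d ∣ p ^ α * q) (hc : c ∣ p ^ α * q) (hR : R < m) (hcR : c ≤ R)
    (hc0 : 0 < c) (hq : 0 < q) {i : ℕ} (hic : p ^ i ∣ c) (hci : ¬ p ^ (i + 1 + 1) ∣ c)
    (hib : p ^ i ≤ b) (hib' : i = 0 ∨ p ^ (i + 1) ≤ b + 1) :
    Expands ∅ (linkComplex m k c R fun d => 0 < d ∧ d ≤ b ∧ ¬ p ^ (i + 1 + 1) ∣ d) := by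
  have hpi : 0 < p ^ i := pow_pos hp.pos _
  have hkp : p ^ (i + 1) * q ≤ k * p ^ i := by
    rw [pow_succ, mul_assoc, mul_comm]; exact Nat.mul_le_mul_right _ hk
  by_cases hx : p ^ (i + 1) * q ≤ R
  · refine Expands.of_cone (m - p ^ (i + 1) * q) (linkComplex_isLowerSet _)
      (linkComplex_finite _) ?_
    rintro s ⟨d, ⟨hd0, hdb, hdp⟩, h⟩
    -- A difference below `p ^ i` is replaced by a multiple in `[p ^ i, p ^ (i + 1))`: it still
    -- divides all distances because `p ^ i ∣ c`, and it is at most `b` by `hib'`.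
    obtain ⟨e, he0, heb, hep, hei, hes⟩ : ∃ e, 0 < e ∧ e ≤ b ∧ ¬ p ^ (i + 1 + 1) ∣ e ∧ p ^ i ≤ e ∧
        ∀ v ∈ s, v < m ∧ e ∣ m - v ∧ c ∣ m - v ∧ m - v ≤ k * e ∧ m - v ≤ R := by
      by_cases hdi : p ^ i ≤ d
      · exact ⟨d, hd0, hdb, hdp, hdi, h⟩
      have hi0 : i ≠ 0 := by rintro rfl; simp at hdi; omega
      have hib1 := hib'.resolve_left hi0
      have hlt : d < p ^ (i + 1) := by
        have := Nat.pow_lt_pow_right hp.one_lt (Nat.lt_succ_self i)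
        simp only [Nat.succ_eq_add_one] at this
        omega
      obtain ⟨j, hj1, hj2⟩ := hp.exists_mul_pow_mem_Ico hd0 hlt
      have hpos : 0 < d * p ^ j := Nat.mul_pos hd0 (pow_pos hp.pos _)
      refine ⟨d * p ^ j, hpos, by omega, fun hdv => ?_, hj1, fun v hv => ?_⟩
      · have := Nat.le_of_dvd hpos hdv
        have := Nat.pow_lt_pow_right hp.one_lt (Nat.lt_succ_self (i + 1))
        simp only [Nat.succ_eq_add_one] at this
        omega
      · obtain ⟨h1, h2, h3, h4, h5⟩ := h v hv
        refine ⟨h1, hp.mul_pow_dvd_of_lt hd0 hj2 h2 (hic.trans h3), h3, h4.trans ?_, h5⟩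
        exact Nat.mul_le_mul_left _ (Nat.le_mul_of_pos_right _ (pow_pos hp.pos _))
    refine ⟨e, ⟨he0, heb, hep⟩, fun v hv => ?_⟩
    rcases Finset.mem_insert.1 hv with rfl | hv
    · have hxpos : 0 < p ^ (i + 1) * q := Nat.mul_pos (pow_pos hp.pos _) hq
      have : m - (m - p ^ (i + 1) * q) = p ^ (i + 1) * q := by omega
      rw [this]
      exact ⟨by omega, hp.dvd_pow_mul_of_not_pow_succ_dvd (hb e he0 heb) hep,
        hp.dvd_pow_mul_of_not_pow_succ_dvd hc hci, hkp.trans (Nat.mul_le_mul_left _ hei), hx⟩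
    · exact hes v hv
  -- All distances are now below `p ^ (i + 1) * q ≤ k * p ^ i` and divisible by `p ^ i`, so the
  -- single difference `p ^ i` serves every face, and the nearest candidate point is an apex.
  · refine Expands.of_cone (m - c) (linkComplex_isLowerSet _) (linkComplex_finite _) ?_
    rintro s ⟨d, -, h⟩
    refine ⟨p ^ i, ⟨hpi, hib, fun hdv => ?_⟩, fun v hv => ?_⟩
    · have := (Nat.pow_dvd_pow_iff_le_right hp.one_lt).1 hdv
      omega
    rcases Finset.mem_insert.1 hv with rfl | hv
    · have : m - (m - c) = c := by omega
      rw [this]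
      exact ⟨by omega, hic, dvd_rfl, by omega, hcR⟩
    · obtain ⟨h1, -, h3, -, h5⟩ := h v hv
      exact ⟨h1, hic.trans h3, h3, by omega, h5⟩

/-- Allowing one more factor `p` in the differences is an expansion. -/
theorem expands_linkComplex_step (hp : p.Prime) (hk : p * q ≤ k)
    (hb : ∀ d, 0 < d → d ≤ b → d ∣ p ^ α * q) (hc : c ∣ p ^ α * q) (hR : R < m)
    (hq : 0 < q) {i : ℕ} (hci : ¬ p ^ (i + 1) ∣ c) :
    Expands (linkComplex m k c R fun d => 0 < d ∧ d ≤ b ∧ ¬ p ^ (i + 1) ∣ d)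
      (linkComplex m k c R fun d => 0 < d ∧ d ≤ b ∧ ¬ p ^ (i + 1 + 1) ∣ d) := by
  have hpi : 0 < p ^ i := pow_pos hp.pos _
  have hlt1 : p ^ i < p ^ (i + 1) := Nat.pow_lt_pow_right hp.one_lt (Nat.lt_succ_self i)
  have hkp : p ^ (i + 1) * q ≤ k * p ^ i := by
    rw [pow_succ, mul_assoc, mul_comm]; exact Nat.mul_le_mul_right _ hk
  have hci2 : ¬ p ^ (i + 1 + 1) ∣ c := fun h => hci ((pow_dvd_pow p (Nat.le_succ _)).trans h)
  have hcq := hp.dvd_pow_mul_of_not_pow_succ_dvd hc hci2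
  have hsub : (linkComplex m k c R fun d => 0 < d ∧ d ≤ b ∧ ¬ p ^ (i + 1) ∣ d) ⊆
      linkComplex m k c R fun d => 0 < d ∧ d ≤ b ∧ ¬ p ^ (i + 1 + 1) ∣ d :=
    fun s ⟨d, ⟨h1, h2, h3⟩, h⟩ =>
      ⟨d, ⟨h1, h2, fun h' => h3 ((pow_dvd_pow p (Nat.le_succ _)).trans h')⟩, h⟩
  by_cases hx : p ^ (i + 1) * q ≤ R
  · refine Expands.of_toggle (m - p ^ (i + 1) * q) (linkComplex_isLowerSet _)
      (linkComplex_isLowerSet _) ((linkComplex_finite _).subset Set.sdiff_subset) hsub ?_ ?_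
    all_goals
      rintro s ⟨d, ⟨hd0, hdb, hdp⟩, h⟩ hs
      have hpd : p ^ (i + 1) ∣ d := by
        by_contra hpd; exact hs ⟨d, ⟨hd0, hdb, hpd⟩, h⟩
      have hple := Nat.le_of_dvd hd0 hpd
      have hxpos : 0 < p ^ (i + 1) * q := Nat.mul_pos (pow_pos hp.pos _) hq
      have hmm : m - (m - p ^ (i + 1) * q) = p ^ (i + 1) * q := by omega
    · refine ⟨d, ⟨hd0, hdb, hdp⟩, fun v hv => ?_⟩
      rcases Finset.mem_insert.1 hv with rfl | hv
      · rw [hmm]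
        exact ⟨by omega, hp.dvd_pow_mul_of_not_pow_succ_dvd (hb d hd0 hdb) hdp, hcq,
          hkp.trans (Nat.mul_le_mul_left _ (by omega)), hx⟩
      · exact h v hv
    · rintro ⟨e, ⟨he0, heb, hep⟩, h'⟩
      apply hs
      -- If erasing the apex gave an old face, its difference could be raised to at least `p ^ i`,
      -- since `p ^ (i + 1) ∣ d` makes the distances divisible by `p ^ i`. The apex would then fit
      -- back, making `s` itself old.
      obtain ⟨f, hf0, hfb, hfp, hfi, hfs⟩ : ∃ f, 0 < f ∧ f ≤ b ∧ ¬ p ^ (i + 1) ∣ f ∧ p ^ i ≤ f ∧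
          ∀ v ∈ s.erase (m - p ^ (i + 1) * q),
            v < m ∧ f ∣ m - v ∧ c ∣ m - v ∧ m - v ≤ k * f ∧ m - v ≤ R := by
        by_cases hei : p ^ i ≤ e
        · exact ⟨e, he0, heb, hep, hei, h'⟩
        obtain ⟨j, hj1, hj2⟩ := hp.exists_mul_pow_mem_Ico he0 (i := i) (by omega)
        have hpos : 0 < e * p ^ j := Nat.mul_pos he0 (pow_pos hp.pos _)
        refine ⟨e * p ^ j, hpos, by omega, fun hdv => ?_, hj1, fun v hv => ?_⟩
        · have := Nat.le_of_dvd hpos hdv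
          omega
        · obtain ⟨h1, h2, h3, h4, h5⟩ := h' v hv
          have hdv := (h v (Finset.mem_of_mem_erase hv)).2.1
          refine ⟨h1, hp.mul_pow_dvd_of_lt he0 hj2 h2
            (((pow_dvd_pow p (Nat.le_succ i)).trans hpd).trans hdv), h3, h4.trans ?_, h5⟩
          exact Nat.mul_le_mul_left _ (Nat.le_mul_of_pos_right _ (pow_pos hp.pos _))
      refine ⟨f, ⟨hf0, hfb, hfp⟩, fun v hv => ?_⟩
      by_cases hvx : v = m - p ^ (i + 1) * q
      · rw [hvx, hmm]
        exact ⟨by omega, (hp.dvd_pow_mul_of_not_pow_succ_dvd (hb f hf0 hfb) fun h =>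
            hfp ((pow_dvd_pow p (Nat.le_succ _)).trans h)), hcq,
          hkp.trans (Nat.mul_le_mul_left _ hfi), hx⟩
      · exact hfs v (Finset.mem_erase.2 ⟨hvx, hv⟩)
  -- When the apex is out of range nothing new appears: a difference divisible by `p ^ (i + 1)` can
  -- be replaced by `p ^ i`, whose reach `k * p ^ i` exceeds `R`.
  · rw [hsub.antisymm]
    · exact Relation.ReflTransGen.refl
    rintro s ⟨d, ⟨hd0, hdb, hdp⟩, h⟩
    by_cases hpd : p ^ (i + 1) ∣ d
    · have hple := Nat.le_of_dvd hd0 hpd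
      refine ⟨p ^ i, ⟨hpi, by omega, fun hdv => ?_⟩, fun v hv => ?_⟩
      · have := Nat.le_of_dvd hpi hdv
        omega
      obtain ⟨h1, h2, h3, -, h5⟩ := h v hv
      exact ⟨h1, ((pow_dvd_pow p (Nat.le_succ i)).trans hpd).trans h2, h3, by omega, h5⟩
    · exact ⟨d, ⟨hd0, hdb, hpd⟩, h⟩

/-- The filtration starts at the valuation of `c`: the base needs `c` divisible by `p ^ i`, the
steps need `c` not divisible by the higher powers. The bound `c ≤ b + 1` is what lets raised
differences stay at most `b`. -/
theorem expands_linkComplex (hp : p.Prime) (hk : p * q ≤ k)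
    (hb : ∀ d, 0 < d → d ≤ b → d ∣ p ^ α * q) (hc : c ∣ p ^ α * q) (hR : R < m) (hcR : c ≤ R)
    (hc0 : 0 < c) (hq : 0 < q) (hb0 : 0 < b) (hcb : c ≤ b + 1) :
    Expands ∅ (linkComplex m k c R fun d => 0 < d ∧ d ≤ b) := by
  obtain ⟨s, u, hu, hcu⟩ := Nat.exists_eq_pow_mul_and_not_dvd hc0.ne' p hp.ne_one
  have hnot : ∀ j, s < j → ¬ p ^ j ∣ c := by
    intro j hj hdv
    rw [hcu] at hdv
    have : p ^ s * p ∣ p ^ s * u := by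
      rw [← pow_succ]; exact (pow_dvd_pow p hj).trans hdv
    exact hu (Nat.dvd_of_mul_dvd_mul_left (pow_pos hp.pos _) this)
  obtain ⟨i, hi, hbase⟩ : ∃ i, s ≤ i + 1 ∧
      Expands ∅ (linkComplex m k c R fun d => 0 < d ∧ d ≤ b ∧ ¬ p ^ (i + 1 + 1) ∣ d) := by
    rcases Nat.eq_zero_or_pos s with h0 | h0
    · exact ⟨0, by omega, expands_linkComplex_base hp hk hb hc hR hcR hc0 hq (by simp)
        (hnot _ (by omega)) (by rwa [pow_zero]) (Or.inl rfl)⟩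
    · obtain ⟨i, rfl⟩ : ∃ i, s = i + 1 := ⟨s - 1, by omega⟩
      have hle : p ^ (i + 1) ≤ c := Nat.le_of_dvd hc0 (hcu ▸ Dvd.intro _ rfl)
      have hlt : p ^ i < p ^ (i + 1) := Nat.pow_lt_pow_right hp.one_lt (Nat.lt_succ_self i)
      exact ⟨i, le_rfl, expands_linkComplex_base hp hk hb hc hR hcR hc0 hq
        ((pow_dvd_pow p (Nat.le_succ i)).trans (hcu ▸ Dvd.intro _ rfl))
        (hnot _ (by omega)) (by omega) (Or.inr (by omega))⟩
  have hall : ∀ j, Expands ∅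
      (linkComplex m k c R fun d => 0 < d ∧ d ≤ b ∧ ¬ p ^ (i + j + 1 + 1) ∣ d) := by
    intro j
    induction j with
    | zero => exact hbase
    | succ j ih =>
      exact ih.trans (expands_linkComplex_step hp hk hb hc hR hq (i := i + j + 1)
        (hnot _ (by omega)))
  -- For so large an exponent the power of `p` exceeds `b`, so the valuation condition is vacuous.
  convert! hall b using 3 with d
  refine ⟨fun h => ⟨h.1, h.2, fun hdv => ?_⟩, fun h => ⟨h.1, h.2.1⟩⟩
  have h1 := Nat.le_of_dvd h.1 hdv
  have h2 : i + b + 1 + 1 < p ^ (i + b + 1 + 1) := Nat.lt_pow_self hp.one_lt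
  omega

end Link

/-! ### Building a progression point by point. -/

/-- The finite subsets of `{r, r + c, …, r + N * c}` whose differences are, for one positive
`d ≤ b`, multiples of `d` that are at most `k * d`. -/
def progressionComplex (k b c r N : ℕ) : Set (Finset ℕ) :=
  {s | ∃ d, 0 < d ∧ d ≤ b ∧ (∀ v ∈ s, ∃ j ≤ N, v = r + c * j) ∧
    ∀ u ∈ s, ∀ v ∈ s, u ≤ v → d ∣ v - u ∧ v - u ≤ k * d}

section Progression

variable {k b c r N : ℕ}

theorem progressionComplex_isLowerSet : IsLowerSet (progressionComplex k b c r N) :=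
  fun _ _ hts ⟨d, hd0, hdb, h1, h2⟩ => ⟨d, hd0, hdb, fun v hv => h1 v (hts hv),
    fun u hu v hv => h2 u (hts hu) v (hts hv)⟩

theorem progressionComplex_finite : (progressionComplex k b c r N).Finite :=
  (Finset.finite_toSet (((Finset.range (N + 1)).image fun j => r + c * j).powerset)).subset
    fun _ ⟨_, _, _, h, _⟩ => Finset.mem_coe.2 (Finset.mem_powerset.2 fun v hv => by
      obtain ⟨j, hj, rfl⟩ := h v hv
      exact Finset.mem_image.2 ⟨j, Finset.mem_range.2 (by omega), rfl⟩)

/-- The new point is the largest, and `v - u` is the difference of the distances of `u` and `v` to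
it; hence conditions on these distances imply the pairwise ones. -/
theorem progressionComplex_succ (hc0 : 0 < c) :
    progressionComplex k b c r (N + 1) = progressionComplex k b c r N ∪
      insert (r + c * (N + 1)) ''
        linkComplex (r + c * (N + 1)) k c (c * (N + 1)) fun d => 0 < d ∧ d ≤ b := by
  ext s
  constructor
  · rintro ⟨d, hd0, hdb, h1, h2⟩
    by_cases hm : r + c * (N + 1) ∈ s
    · refine Or.inr ⟨s.erase (r + c * (N + 1)), ⟨d, ⟨hd0, hdb⟩, fun v hv => ?_⟩,
        Finset.insert_erase hm⟩
      obtain ⟨hne, hv⟩ := Finset.mem_erase.1 hv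
      obtain ⟨j, hj, rfl⟩ := h1 v hv
      have hle : c * j ≤ c * (N + 1) := Nat.mul_le_mul_left c hj
      have hsub : r + c * (N + 1) - (r + c * j) = c * (N + 1 - j) := by
        rw [Nat.mul_sub]; omega
      obtain ⟨h3, h4⟩ := h2 _ hv _ hm (by omega)
      refine ⟨by omega, h3, hsub ▸ Dvd.intro _ rfl, h4, ?_⟩
      rw [hsub]; exact Nat.mul_le_mul_left _ (Nat.sub_le _ _)
    · refine Or.inl ⟨d, hd0, hdb, fun v hv => ?_, h2⟩
      obtain ⟨j, hj, rfl⟩ := h1 v hv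
      exact ⟨j, Nat.le_of_lt_succ (lt_of_le_of_ne hj (by rintro rfl; exact hm hv)), rfl⟩
  · rintro (⟨d, hd0, hdb, h1, h2⟩ | ⟨t, ⟨d, ⟨hd0, hdb⟩, h⟩, rfl⟩)
    · refine ⟨d, hd0, hdb, fun v hv => ?_, h2⟩
      obtain ⟨j, hj, rfl⟩ := h1 v hv
      exact ⟨j, by omega, rfl⟩
    · refine ⟨d, hd0, hdb, fun v hv => ?_, fun u hu v hv huv => ?_⟩
      · rcases Finset.mem_insert.1 hv with rfl | hv
        · exact ⟨N + 1, le_rfl, rfl⟩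
        obtain ⟨h1, -, ⟨j, hj⟩, -, h5⟩ := h v hv
        have hjN : j ≤ N + 1 := Nat.le_of_mul_le_mul_left (hj ▸ h5) hc0
        refine ⟨N + 1 - j, by omega, ?_⟩
        rw [Nat.mul_sub, ← hj]
        omega
      · have key : ∀ x ∈ insert (r + c * (N + 1)) t, x ≤ r + c * (N + 1) ∧
            d ∣ r + c * (N + 1) - x ∧ r + c * (N + 1) - x ≤ k * d := by
          intro x hx
          rcases Finset.mem_insert.1 hx with rfl | hx
          · simp
          · obtain ⟨h1, h2, -, h4, -⟩ := h x hx
            exact ⟨h1.le, h2, h4⟩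
        obtain ⟨hu1, hu2, hu3⟩ := key u hu
        obtain ⟨hv1, hv2, hv3⟩ := key v hv
        have hsub : v - u = (r + c * (N + 1) - u) - (r + c * (N + 1) - v) := by omega
        exact ⟨hsub ▸ Nat.dvd_sub hu2 hv2, by omega⟩

theorem linkComplex_subset_progressionComplex (hc0 : 0 < c) :
    (linkComplex (r + c * (N + 1)) k c (c * (N + 1)) fun d => 0 < d ∧ d ≤ b) ⊆
      progressionComplex k b c r N := by
  intro s hs
  have hms : r + c * (N + 1) ∉ s := by
    obtain ⟨d, -, h⟩ := hs
    exact fun hm => (h _ hm).1.false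
  have hmem : insert (r + c * (N + 1)) s ∈ progressionComplex k b c r (N + 1) := by
    rw [progressionComplex_succ hc0]
    exact Or.inr ⟨s, hs, rfl⟩
  obtain ⟨d, hd0, hdb, h1, h2⟩ := progressionComplex_isLowerSet (Finset.subset_insert _ _) hmem
  refine ⟨d, hd0, hdb, fun v hv => ?_, h2⟩
  obtain ⟨j, hj, rfl⟩ := h1 v hv
  exact ⟨j, Nat.le_of_lt_succ (lt_of_le_of_ne hj (by rintro rfl; exact hms hv)), rfl⟩

theorem expands_progressionComplex {p q α : ℕ} (hp : p.Prime) (hk : p * q ≤ k)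
    (hb : ∀ d, 0 < d → d ≤ b → d ∣ p ^ α * q) (hc : c ∣ p ^ α * q)
    (hc0 : 0 < c) (hq : 0 < q) (hb0 : 0 < b) (hcb : c ≤ b + 1) (hr : 0 < r) (N : ℕ) :
    Expands ∅ (progressionComplex k b c r N) := by
  induction N with
  | zero =>
    refine Expands.of_cone r progressionComplex_isLowerSet progressionComplex_finite ?_
    rintro s ⟨d, hd0, hdb, h1, -⟩
    have hsr : ∀ v ∈ insert r s, v = r := by
      intro v hv
      rcases Finset.mem_insert.1 hv with rfl | hv
      · rfl
      obtain ⟨j, hj, rfl⟩ := h1 v hv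
      simp [Nat.le_zero.1 hj]
    refine ⟨d, hd0, hdb, fun v hv => ⟨0, le_rfl, by simp [hsr v hv]⟩, fun u hu v hv _ => ?_⟩
    simp [hsr u hu, hsr v hv]
  | succ N ih =>
    rw [progressionComplex_succ hc0]
    refine ih.trans (Expands.union_insert progressionComplex_isLowerSet ?_ ?_
      (linkComplex_subset_progressionComplex hc0))
    · rintro s ⟨d, -, -, h1, -⟩ hm
      obtain ⟨j, hj, hjm⟩ := h1 _ hm
      have := Nat.eq_of_mul_eq_mul_left hc0 (Nat.add_left_cancel hjm)
      omega
    · exact expands_linkComplex hp hk hb hc (by omega)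
        (Nat.le_mul_of_pos_right _ (Nat.succ_pos _)) hc0 hq hb0 hcb

end Progression

/-! ### Passage from the geometric realization to families of subsets of `ℕ`. -/

theorem geometricRealization_eq_barycentricSpace {V : Type*} [Fintype V]
    (K : AbstractSimplicialComplex V) : geometricRealization K = barycentricSpace K.faces := by
  classical
  have hface : ∀ s : Finset V,
      convexHull ℝ ((s.image fun v => (Pi.single v 1 : V → ℝ) : Finset (V → ℝ)) : Set (V → ℝ)) =
        {x | (∀ v, 0 ≤ x v) ∧ (∀ v ∉ s, x v = 0) ∧ ∑ v ∈ s, x v = 1} := by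
    intro s
    apply Set.Subset.antisymm
    · refine convexHull_min ?_ ?_
      · intro x hx
        obtain ⟨v, hv, rfl⟩ := Finset.mem_image.1 (Finset.mem_coe.1 hx)
        refine ⟨fun u => ?_, fun u hu => ?_, ?_⟩
        · by_cases h : u = v
          · subst h; simp
          · rw [Pi.single_eq_of_ne h]
        · exact Pi.single_eq_of_ne (ne_of_mem_of_not_mem hv hu).symm _
        · simp [Pi.single_apply, hv]
      · rintro x ⟨hx0, hxs, hx1⟩ y ⟨hy0, hys, hy1⟩ α β hα hβ hαβ
        refine ⟨fun v => ?_, fun v hv => ?_, ?_⟩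
        · have := hx0 v
          have := hy0 v
          simp only [Pi.add_apply, Pi.smul_apply, smul_eq_mul]
          positivity
        · simp [hxs v hv, hys v hv]
        · simp only [Pi.add_apply, Pi.smul_apply, smul_eq_mul, Finset.sum_add_distrib,
            ← Finset.mul_sum, hx1, hy1]
          linarith
    · rintro x ⟨h0, hs, h1⟩
      have hx : x = ∑ v ∈ s, x v • (Pi.single v 1 : V → ℝ) := by
        ext u
        simp only [Finset.sum_apply, Pi.smul_apply, smul_eq_mul, Pi.single_apply, mul_ite, mul_one,
          mul_zero, Finset.sum_ite_eq]
        split_ifs with h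
        · rfl
        · exact hs u h
      rw [hx]
      refine (convex_convexHull ℝ _).sum_mem (fun v _ => h0 v) h1 fun v hv => ?_
      exact subset_convexHull ℝ _ (Finset.mem_coe.2 (Finset.mem_image_of_mem _ hv))
  ext x
  rw [Geometry.SimplicialComplex.mem_space_iff]
  constructor
  · rintro ⟨_, ⟨s, hs, rfl⟩, hx⟩
    refine ⟨s, hs, ?_⟩
    have := hface s
    have hx' := this.subset (by convert hx)
    exact hx'
  · rintro ⟨s, hs, hx⟩
    refine ⟨_, ⟨s, hs, rfl⟩, ?_⟩
    have hx' := (hface s).superset hx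
    convert hx'

/-- Enlarging the ambient vertex set does not change the realization. -/
def barycentricSpaceMapHomeomorph (P : Finset ℕ) (K : Set (Finset P)) :
    barycentricSpace K ≃ₜ
      barycentricSpace {s | s = ∅ ∨ ∃ t ∈ K, t.map (Function.Embedding.subtype _) = s} where
  toFun x := ⟨fun v => if h : v ∈ P then x.1 ⟨v, h⟩ else 0, by
    obtain ⟨x, t, ht, h0, hs, h1⟩ := x
    refine ⟨_, Or.inr ⟨t, ht, rfl⟩, fun v => ?_, fun v hv => ?_, ?_⟩
    · dsimp only
      split_ifs with h
      exacts [h0 _, le_rfl]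
    · dsimp only
      split_ifs with h
      · refine hs _ fun hvt => hv (Finset.mem_map.2 ⟨_, hvt, rfl⟩)
      · rfl
    · rw [Finset.sum_map]
      simpa using h1⟩
  invFun y := ⟨fun v => y.1 v.1, by
    obtain ⟨y, _, (rfl | ⟨t, ht, rfl⟩), h0, hs, h1⟩ := y
    · simp at h1
    · refine ⟨t, ht, fun v => h0 _, fun v hv => hs _ fun h => hv ?_, by simpa using h1⟩
      obtain ⟨u, hu, huv⟩ := Finset.mem_map.1 h
      exact (Subtype.ext huv : u = v) ▸ hu⟩
  left_inv x := by
    ext v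
    simp
  right_inv y := by
    obtain ⟨y, s, hs, h0, hsupp, h1⟩ := y
    apply Subtype.ext
    ext v
    dsimp only
    split_ifs with h
    · rfl
    · refine (hsupp v fun hv => ?_).symm
      rcases hs with rfl | ⟨t, -, rfl⟩
      · simp at hv
      · obtain ⟨u, -, rfl⟩ := Finset.mem_map.1 hv
        exact h u.2
  continuous_toFun := by
    refine Continuous.subtype_mk (continuous_pi fun v => ?_) _
    by_cases h : v ∈ P
    · simp only [h, dif_pos]
      exact (continuous_apply _).comp continuous_subtype_val
    · simp only [h, dif_neg, not_false_eq_true]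
      exact continuous_const
  continuous_invFun := by
    refine Continuous.subtype_mk (continuous_pi fun v => ?_) _
    exact (continuous_apply _).comp continuous_subtype_val

/-! ### Gluing residue classes and identifying the van der Waerden complex. -/

/-- A set of residue-class elements of `[1, n]` whose differences are multiples of `d` of size at
most `k * d` lies in a progression inside `[1, n]`. -/
theorem exists_subset_arithProg {n k d y : ℕ} {s : Finset ℕ} (hs : s.Nonempty) (hd : 0 < d)
    (hy : 0 < y) (hyn : y + k * d ≤ n) (hsn : ∀ v ∈ s, v ≤ n)
    (hmod : ∀ v ∈ s, ∃ j, v = y + d * j)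
    (hdiff : ∀ u ∈ s, ∀ v ∈ s, u ≤ v → v - u ≤ k * d) :
    ∃ x, 0 < x ∧ x + k * d ≤ n ∧ s ⊆ arithProg k x d := by
  obtain ⟨i, hi⟩ := hmod _ (s.min'_mem hs)
  let S := (Finset.range (i + 1)).filter fun j => y + d * j + k * d ≤ n
  -- Take the last admissible start not beyond the minimum of `s`. Either it is that minimum, and
  -- the span bound suffices, or the next start would overrun `n`, so the progression reaches every
  -- later point of the class.
  have hS : S.Nonempty := ⟨0, by simp [S, hyn]⟩
  obtain ⟨e, hSmem, hSmax⟩ : ∃ e ∈ S, ∀ j ∈ S, j ≤ e :=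
    ⟨S.max' hS, S.max'_mem hS, fun j hj => S.le_max' j hj⟩
  simp only [S, Finset.mem_filter, Finset.mem_range] at hSmem hSmax
  refine ⟨y + d * e, by omega, hSmem.2, fun v hv => ?_⟩
  obtain ⟨j, hj⟩ := hmod v hv
  have hle : y + d * i ≤ y + d * j := hi ▸ hj ▸ s.min'_le v hv
  have hij : i ≤ j := Nat.le_of_mul_le_mul_left (by omega) hd
  have hspan := hdiff _ (s.min'_mem hs) v hv (s.min'_le v hv)
  have hvn := hsn v hv
  rw [hi, hj] at hspan
  have hjk : j ≤ e + k := by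
    by_cases hei : e = i
    · have h1 : d * (j - i) ≤ d * k := by rw [Nat.mul_sub, mul_comm d k]; omega
      have := Nat.le_of_mul_le_mul_left h1 hd
      omega
    · by_contra hlt
      have h1 : ¬ y + d * (e + 1) + k * d ≤ n := fun h => by
        have := hSmax (e + 1) ⟨by omega, h⟩
        omega
      have h2 : d * (e + 1 + k) ≤ d * j := Nat.mul_le_mul_left d (by omega)
      rw [Nat.mul_add, mul_comm d k] at h2
      omega
  refine Finset.mem_image.2 ⟨j - e, Finset.mem_range.2 (by omega), ?_⟩
  have h3 : d * e ≤ d * j := Nat.mul_le_mul_left d (by omega)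
  rw [Nat.sub_mul, mul_comm e d, mul_comm j d]
  omega

/-- The faces with differences less than `a`, together with the full progressions of difference
`a` in the residue classes of `1, …, ρ`. -/
def residueFiltration (n k a ρ : ℕ) : Set (Finset ℕ) :=
  {s | s ∈ progressionComplex k (a - 1) 1 1 (n - 1) ∨
    ∃ r, 0 < r ∧ r ≤ ρ ∧ s ∈ progressionComplex k a a r ((n - r) / a)}

theorem pos_and_le_of_mem_progressionComplex {n k b a r : ℕ} {s : Finset ℕ} (hr : 0 < r)
    (hrn : r ≤ n) (hs : s ∈ progressionComplex k b a r ((n - r) / a)) {v : ℕ} (hv : v ∈ s) :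
    0 < v ∧ v ≤ n := by
  obtain ⟨d, -, -, h, -⟩ := hs
  obtain ⟨j, hj, rfl⟩ := h v hv
  have h1 : a * j ≤ n - r := (Nat.mul_le_mul_left a hj).trans (Nat.mul_div_le _ _)
  omega

theorem progressionComplex_one_iff {n k b : ℕ} (hn : 0 < n) {s : Finset ℕ} :
    s ∈ progressionComplex k b 1 1 (n - 1) ↔ ∃ d, 0 < d ∧ d ≤ b ∧ (∀ v ∈ s, 0 < v ∧ v ≤ n) ∧
      ∀ u ∈ s, ∀ v ∈ s, u ≤ v → d ∣ v - u ∧ v - u ≤ k * d := by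
  refine exists_congr fun d => and_congr_right fun _ => and_congr_right fun _ =>
    and_congr_left fun _ => forall₂_congr fun v _ => ⟨?_, fun h => ⟨v - 1, by omega, by omega⟩⟩
  rintro ⟨j, hj, rfl⟩
  omega

theorem residueFiltration_isLowerSet (n k a ρ : ℕ) : IsLowerSet (residueFiltration n k a ρ) := by
  rintro s t hts (h | ⟨r, h0, h1, h⟩)
  · exact Or.inl (progressionComplex_isLowerSet hts h)
  · exact Or.inr ⟨r, h0, h1, progressionComplex_isLowerSet hts h⟩

theorem contractibleSpace_residueFiltration {n k a p q α : ℕ} (hp : p.Prime) (hk : p * q ≤ k)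
    (ha : 1 < a) (hdvd : ∀ d, 0 < d → d ≤ a → d ∣ p ^ α * q) (hq : 0 < q) (hn : 0 < n) (ρ : ℕ)
    (hρa : ρ ≤ a) (hρn : ρ ≤ n) :
    ContractibleSpace (barycentricSpace (residueFiltration n k a ρ)) := by
  have hempty : ∀ b c r N, 0 < b → ∅ ∈ progressionComplex k b c r N := fun b c r N hb =>
    ⟨1, one_pos, hb, by simp, by simp⟩
  induction ρ with
  | zero =>
    have h0 : residueFiltration n k a 0 = progressionComplex k (a - 1) 1 1 (n - 1) := by
      ext s
      refine ⟨?_, Or.inl⟩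
      rintro (h | ⟨r, h0, h1, -⟩)
      · exact h
      · omega
    rw [h0]
    exact (expands_progressionComplex hp hk (fun d h0 h1 => hdvd d h0 (by omega)) (one_dvd _)
      one_pos hq (by omega) (by omega) one_pos _).contractibleSpace (hempty _ _ _ _ (by omega))
  | succ ρ ih =>
    have hih := ih (by omega) (by omega)
    have hsucc : residueFiltration n k a (ρ + 1) = residueFiltration n k a ρ ∪
        progressionComplex k a a (ρ + 1) ((n - (ρ + 1)) / a) := by
      ext s
      constructor
      · rintro (h | ⟨r, h0, h1, h⟩)
        · exact Or.inl (Or.inl h)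
        · rcases Nat.lt_or_ge ρ r with hr | hr
          · obtain rfl : r = ρ + 1 := by omega
            exact Or.inr h
          · exact Or.inl (Or.inr ⟨r, h0, hr, h⟩)
      · rintro ((h | ⟨r, h0, h1, h⟩) | h)
        · exact Or.inl h
        · exact Or.inr ⟨r, h0, by omega, h⟩
        · exact Or.inr ⟨ρ + 1, by omega, le_rfl, h⟩
    -- Earlier classes share only `∅` with class `ρ + 1`, the residues being distinct mod `a`; so
    -- the overlap comes from the differences below `a`.
    have hinter : residueFiltration n k a ρ ∩
        progressionComplex k a a (ρ + 1) ((n - (ρ + 1)) / a) =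
          progressionComplex k (a - 1) a (ρ + 1) ((n - (ρ + 1)) / a) := by
      ext s
      constructor
      · rintro ⟨h | ⟨r, h0, h1, h⟩, hs⟩
        · obtain ⟨d, hd0, hda, -, hd⟩ := h
          obtain ⟨-, -, -, hs, -⟩ := hs
          exact ⟨d, hd0, hda, hs, hd⟩
        · obtain rfl : s = ∅ := by
            refine Finset.eq_empty_of_forall_notMem fun v hv => ?_
            obtain ⟨-, -, -, h, -⟩ := h
            obtain ⟨-, -, -, hs, -⟩ := hs
            obtain ⟨j, -, hj⟩ := h v hv
            obtain ⟨j', -, hj'⟩ := hs v hv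
            have hmod : r ≡ ρ + 1 [MOD a] := by
              have : (r + a * j) % a = (ρ + 1 + a * j') % a := by rw [← hj, ← hj']
              rwa [Nat.add_mul_mod_self_left, Nat.add_mul_mod_self_left] at this
            have hdiv : a ∣ ρ + 1 - r := (Nat.modEq_iff_dvd' (by omega)).1 hmod
            have := Nat.le_of_dvd (by omega) hdiv
            omega
          exact hempty _ _ _ _ (by omega)
      · intro h
        have hmem := fun v (hv : v ∈ s) =>
          pos_and_le_of_mem_progressionComplex (by omega) hρn h hv
        obtain ⟨d, hd0, hda, hs, hd⟩ := h
        exact ⟨Or.inl ((progressionComplex_one_iff hn).2 ⟨d, hd0, hda, hmem, hd⟩),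
          d, hd0, by omega, hs, hd⟩
    have hw : ∀ s ∈ residueFiltration n k a ρ, 0 ∉ s := by
      rintro s (h | ⟨r, h0, h1, h⟩) hs
      · obtain ⟨-, -, -, h, -⟩ := (progressionComplex_one_iff hn).1 h
        exact (h 0 hs).1.false
      · exact (pos_and_le_of_mem_progressionComplex h0 (by omega) h hs).1.false
    -- The auxiliary cone vertex is `0`, which lies outside `[1, n]`. The overlap has step `a` and
    -- bound `a - 1`, the extreme case of `c ≤ b + 1`.
    obtain ⟨Z, hXZ, hXYZ⟩ := Expands.exists_common (residueFiltration_isLowerSet n k a ρ)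
      progressionComplex_isLowerSet hw
      (fun s hs h0 =>
        (pos_and_le_of_mem_progressionComplex (by omega) hρn hs h0).1.false)
      progressionComplex_finite
      (expands_progressionComplex hp hk hdvd (hdvd a (by omega) le_rfl) (by omega) hq (by omega)
        (by omega) (by omega) ((n - (ρ + 1)) / a))
      (hinter ▸ expands_progressionComplex hp hk (fun d h0 h1 => hdvd d h0 (by omega))
        (hdvd a (by omega) le_rfl) (by omega) hq (by omega) (by omega) (by omega) _)
    have hmem : ∅ ∈ residueFiltration n k a ρ := Or.inl (hempty _ _ _ _ (by omega))
    rw [hsucc, Expands.contractibleSpace_iff hXYZ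
      ((residueFiltration_isLowerSet n k a ρ).union progressionComplex_isLowerSet) (Or.inl hmem),
      ← Expands.contractibleSpace_iff hXZ (residueFiltration_isLowerSet n k a ρ) hmem]
    exact hih

theorem exists_eq_add_mul {s : Finset ℕ} {d y : ℕ} (hs : s.Nonempty)
    (hd : ∀ u ∈ s, ∀ v ∈ s, u ≤ v → d ∣ v - u) (hy : ∃ j, s.min' hs = y + d * j) :
    ∀ v ∈ s, ∃ j, v = y + d * j := by
  intro v hv
  obtain ⟨j, hj⟩ := hy
  obtain ⟨i, hi⟩ := hd _ (s.min'_mem hs) v hv (s.min'_le v hv)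
  have := s.min'_le v hv
  exact ⟨j + i, by rw [Nat.mul_add, ← hi]; omega⟩

/-- For `a * k < n ≤ (a + 1) * k` the faces of the van der Waerden complex are the members of the
last stage of the filtration. -/
theorem vdW_faces_eq_residueFiltration {n k a : ℕ} (ha : 1 < a) (hak : a ≤ k + 1)
    (hn : a * k < n) (hn' : n ≤ (a + 1) * k) :
    {s | s = ∅ ∨ ∃ t ∈ (vdW n k).faces, t.map (Function.Embedding.subtype _) = s} =
      residueFiltration n k a (min a (n - a * k)) := by
  have hn0 : 0 < n := by omega
  have hmod : ∀ d, 0 < d → ∀ v, 0 < v → ∃ y, 0 < y ∧ y ≤ d ∧ y ≤ v ∧ ∃ j, v = y + d * j := by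
    intro d hd v hv
    have h1 := Nat.mod_add_div (v - 1) d
    have h2 := Nat.mod_lt (v - 1) hd
    exact ⟨(v - 1) % d + 1, by omega, by omega, by omega, (v - 1) / d, by omega⟩
  ext s
  constructor
  · rintro (rfl | ⟨t, ⟨ht, ht'⟩, rfl⟩)
    · exact Or.inl ⟨1, one_pos, by omega, by simp, by simp⟩
    rcases ht' with ⟨v, rfl⟩ | ⟨x, d, hd, hx, hlt, hle, hsub⟩
    · refine Or.inl ((progressionComplex_one_iff hn0).2 ⟨1, one_pos, by omega, ?_, ?_⟩)
      · have := Finset.mem_Icc.1 v.2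
        intro u hu
        obtain rfl : u = v := by simpa using hu
        omega
      · intro u hu w hw _
        obtain rfl : u = v := by simpa using hu
        obtain rfl : w = v := by simpa using hw
        simp
    have hform : ∀ v ∈ t.map (Function.Embedding.subtype _), ∃ i ≤ k, v = x + d * i := by
      intro v hv
      obtain ⟨i, hi, rfl⟩ := Finset.mem_image.1 (hsub hv)
      exact ⟨i, Nat.le_of_lt_succ (Finset.mem_range.1 hi), by rw [mul_comm]⟩
    have hdiff : ∀ u ∈ t.map (Function.Embedding.subtype _),
        ∀ v ∈ t.map (Function.Embedding.subtype _), u ≤ v → d ∣ v - u ∧ v - u ≤ k * d := by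
      intro u hu v hv _
      obtain ⟨i, hi, rfl⟩ := hform u hu
      obtain ⟨j, hj, rfl⟩ := hform v hv
      have h1 : x + d * j - (x + d * i) = d * (j - i) := by rw [Nat.mul_sub]; omega
      rw [h1]
      refine ⟨Dvd.intro _ rfl, ?_⟩
      rw [mul_comm k]
      exact Nat.mul_le_mul_left d (by omega)
    have hrange : ∀ v ∈ t.map (Function.Embedding.subtype _), 0 < v ∧ v ≤ n := by
      intro v hv
      obtain ⟨u, -, rfl⟩ := Finset.mem_map.1 hv
      exact Finset.mem_Icc.1 u.2
    have hda : d ≤ a := by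
      by_contra h
      have h1 : k * (a + 1) ≤ k * d := Nat.mul_le_mul_left k (by omega)
      rw [mul_comm k (a + 1)] at h1
      omega
    rcases Nat.lt_or_ge d a with hlt' | hge
    · exact Or.inl ((progressionComplex_one_iff hn0).2 ⟨d, hd, by omega, hrange, hdiff⟩)
    · obtain rfl : d = a := by omega
      obtain ⟨y, hy0, hyd, hyx, j, hj⟩ := hmod d hd x hx
      rw [mul_comm k] at hle
      -- The least representative `y` of the class is at most `x ≤ n - a * k`, which is why only
      -- these residues occur.
      refine Or.inr ⟨y, hy0, le_min hyd (by omega), d, hd, le_rfl, fun v hv => ?_, hdiff⟩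
      obtain ⟨i, hi, hvi⟩ := hform v hv
      have hv2 := (hrange v hv).2
      have heq : v = y + d * (j + i) := by rw [Nat.mul_add]; omega
      refine ⟨j + i, ?_, heq⟩
      rw [Nat.le_div_iff_mul_le hd, mul_comm]
      omega
  · intro hs
    rcases s.eq_empty_or_nonempty with rfl | hne
    · exact Or.inl rfl
    have hk0 : 0 < k := Nat.pos_of_ne_zero fun h => by simp [h] at hn'; omega
    have hface : (∀ v ∈ s, 0 < v ∧ v ≤ n) →
        (∃ x d, 0 < d ∧ 0 < x ∧ x + k * d ≤ n ∧ s ⊆ arithProg k x d) →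
        ∃ t ∈ (vdW n k).faces, t.map (Function.Embedding.subtype _) = s := by
      rintro hrange ⟨x, d, hd, hx, hle, hsub⟩
      have hmap : (s.subtype (· ∈ Finset.Icc 1 n)).map (Function.Embedding.subtype _) = s :=
        Finset.subtype_map_of_mem fun v hv => Finset.mem_Icc.2 (hrange v hv)
      refine ⟨s.subtype (· ∈ Finset.Icc 1 n), ⟨?_, Or.inr ⟨x, d, hd, hx, ?_, hle, ?_⟩⟩, hmap⟩
      · rwa [← Finset.map_nonempty (f := Function.Embedding.subtype _), hmap]
      · have := Nat.mul_pos hk0 hd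
        omega
      · exact hmap.symm ▸ hsub
    refine Or.inr ?_
    rcases hs with h | ⟨r, hr0, hr, h⟩
    · obtain ⟨d, hd0, hda, hrange, hdiff⟩ := (progressionComplex_one_iff hn0).1 h
      obtain ⟨y, hy0, hyd, -, hy⟩ := hmod d hd0 _ (hrange _ (s.min'_mem hne)).1
      -- For `d < a` every residue class has room for a full progression: `y ≤ d ≤ a - 1 ≤ k`, so `y
      -- + k * d ≤ a * k < n`.
      have hyn : y + k * d ≤ n := by
        obtain ⟨b, rfl⟩ : ∃ b, a = b + 1 := ⟨a - 1, by omega⟩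
        have h1 : k * d ≤ k * b := Nat.mul_le_mul_left k (by omega)
        rw [Nat.add_mul, mul_comm b] at hn
        omega
      obtain ⟨x, hx⟩ := exists_subset_arithProg hne hd0 hy0 hyn (fun v hv => (hrange v hv).2)
        (exists_eq_add_mul hne (fun u hu v hv huv => (hdiff u hu v hv huv).1) hy)
        fun u hu v hv huv => (hdiff u hu v hv huv).2
      exact hface hrange ⟨x, d, hd0, hx⟩
    · have hrn : r ≤ n - a * k := hr.trans (min_le_right _ _)
      have hrange := fun v (hv : v ∈ s) =>
        pos_and_le_of_mem_progressionComplex hr0 (by omega) h hv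
      obtain ⟨d, hd0, hda, hform, hdiff⟩ := h
      obtain ⟨x, hx⟩ := exists_subset_arithProg (k := k) (d := a) hne (by omega) hr0
        (by rw [mul_comm k]; omega) (fun v hv => (hrange v hv).2)
        (fun v hv => (hform v hv).imp fun _ h => h.2)
        fun u hu v hv huv => (hdiff u hu v hv huv).2.trans (Nat.mul_le_mul_left k hda)
      exact hface hrange ⟨x, a, by omega, hx⟩

theorem proposition4p1 (a p α k n : ℕ) (ha : 1 < a) (hp : p.Prime) (hα : 1 ≤ α)
    (hdvd : p ^ α ∣ lcmUpTo a) (hndvd : ¬ p ^ (α + 1) ∣ lcmUpTo a)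
    (hk : lcmUpTo a / p ^ (α - 1) ≤ k)
    (hn : a * k < n) (hn' : n ≤ (a + 1) * k) :
    ContractibleSpace (geometricRealization (vdW n k)) := by
  obtain ⟨q, hq⟩ := hdvd
  have hdvd' : ∀ d, 0 < d → d ≤ a → d ∣ p ^ α * q := fun d h0 h1 =>
    hq ▸ Finset.dvd_lcm (f := id) (Finset.mem_Icc.2 ⟨h0, h1⟩)
  have hpq : ¬ p ∣ q := fun h => hndvd (by
    rw [hq, pow_succ]; exact Nat.mul_dvd_mul_left _ h)
  have hq0 : 0 < q := Nat.pos_of_ne_zero fun h => hpq (h ▸ dvd_zero _)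
  have hk' : p * q ≤ k := by
    obtain ⟨β, rfl⟩ : ∃ β, α = β + 1 := ⟨α - 1, by omega⟩
    rwa [hq, Nat.add_sub_cancel, pow_succ, mul_assoc,
      Nat.mul_div_cancel_left _ (pow_pos hp.pos β)] at hk
  -- A number up to `a` prime to `p` divides `q`, hence is at most `k`; one of `a` and `a - 1` is
  -- such a number.
  have hak : a ≤ k + 1 := by
    have hle : ∀ d, 0 < d → d ≤ a → ¬ p ∣ d → d ≤ k := fun d h0 h1 h2 =>
      (Nat.le_of_dvd hq0 (by
        simpa using hp.dvd_pow_mul_of_not_pow_succ_dvd (i := 0) (hdvd' d h0 h1)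
          (by simpa using h2))).trans ((Nat.le_mul_of_pos_left q hp.pos).trans hk')
    by_cases h : p ∣ a
    · have h' : ¬ p ∣ a - 1 := fun h' => hp.one_lt.ne' (Nat.dvd_one.1 (by
        have := Nat.dvd_sub h h'
        rwa [Nat.sub_sub_self ha.le] at this))
      have := hle (a - 1) (by omega) (by omega) h'
      omega
    · have := hle a (by omega) le_rfl h
      omega
  rw [geometricRealization_eq_barycentricSpace]
  have e := barycentricSpaceMapHomeomorph (Finset.Icc 1 n) (vdW n k).faces
  rw [vdW_faces_eq_residueFiltration ha hak hn hn'] at e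
  have := contractibleSpace_residueFiltration hp hk' ha hdvd' hq0 (by omega : 0 < n)
    (min a (n - a * k)) (min_le_left _ _) ((min_le_right _ _).trans (Nat.sub_le _ _))
  exact e.contractibleSpace
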